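/- **Theorem.** Let $p,q$ be positive integers and let $(\bar M,\bar g,\bar J)$ be a metallic semi-Riemannian manifold, i.e. $\bar g$ is a semi-Riemannian metric of constant index and $\bar J$ is a smooth $(1,1)$-tensor field with $\bar J^2=p\bar J+qI$ and $\bar g(U,\bar JV)=\bar g(\bar JU,V)$. Let $\bar\nabla$ be the Levi-Civita connection of $\bar g$, let $\eta$ be a smooth vector field on $\bar M$, $\pi(V)=\bar g(V,\eta)$, and let $\bar D_UV=\bar\nabla_UV+\pi(V)\bar JU$ be the associated quarter symmetric non-metric connection. Let $M$ be an (immersed) lightlike submanifold of $\bar M$: $\mathrm{Rad}(TM)=TM\cap TM^\perp$ has constant rank $r>0$. Choose a screen distribution $S(TM)$ with $TM=\mathrm{Rad}(TM)\perp S(TM)$, a screen transversal bundle $S(TM^\perp)$ with $TM^\perp=\mathrm{Rad}(TM)\perp S(TM^\perp)$, and a lightlike transversal bundle $\mathrm{ltr}(TM)$, i.e. a totally null complement of $\mathrm{Rad}(TM)$ in the orthogonal complement of $S(TM)\perp S(TM^\perp)$; put $\mathrm{tr}(TM)=\mathrm{ltr}(TM)\perp S(TM^\perp)$, so that $T\bar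 M|_M=TM\oplus \mathrm{tr}(TM)$. For $U\in\Gamma(TM)$ and $V\in\Gamma(TM)$ let $D_UV$ be the $TM$-component of $\bar D_UV$, and for $V\in\Gamma(\mathrm{Rad}(TM))$ let $-\bar A^*_VU$ be the $S(TM)$-component of $D_UV$ with respect to $TM=\mathrm{Rad}(TM)\perp S(TM)$. Assume that $M$ is invariant: $\bar J\,\mathrm{Rad}(TM)=\mathrm{Rad}(TM)$ and $\bar J\,S(TM)=S(TM)$. Say that $\mathrm{Rad}(TM)$ defines a totally geodesic foliation if it is involutive and $D_UV\in\Gamma(\mathrm{Rad}(TM))$ for all $U,V\in\Gamma(\mathrm{Rad}(TM))$. Then: 1. $\mathrm{Rad}(TM)$ defines a totally geodesic foliation if and only if $\bar A^*_{\bar JV}U=p\,\bar A^*_VU$ for all $U,V\in\Gamma(\mathrm{Rad}(TM))$. 2. If $q\neq 2p^2$, then $\mathrm{Rad}(TM)$ defines a totally geodesic foliation if and only if $\bar A^*_{\bar JV}U=-p\,\bar A^*_VU$ for all $U,V\in\Gamma(\mathrm{Rad}(TM))$. -/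

import Mathlib

open Bundle Manifold
open scoped Manifold ContDiff Topology

noncomputable section

namespace LightlikeGeometry

/-! ### Metallic semi-Riemannian manifolds and their connections -/

section Ambient

variable {F : Type*} [NormedAddCommGroup F] [NormedSpace ℝ F]
  {N : Type*} [TopologicalSpace N] [ChartedSpace F N] [IsManifold 𝓘(ℝ, F) ∞ N]

variable (F N) in
/-- A semi-Riemannian metric: a smooth, symmetric, nondegenerate `(0,2)`-tensor field of constant
index. The index is the maximal dimension of a subspace on which the form is negative definite. -/
structure SemiRiemannianMetric where
  /-- the bilinear form on each tangent space -/
  form : ∀ y : N, TangentSpace 𝓘(ℝ, F) y →L[ℝ] TangentSpace 𝓘(ℝ, F) y →L[ℝ] ℝ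
  symm : ∀ (y : N) (v w : TangentSpace 𝓘(ℝ, F) y), form y v w = form y w v
  nondegenerate : ∀ (y : N) (v : TangentSpace 𝓘(ℝ, F) y), (∀ w, form y v w = 0) → v = 0
  contMDiff : ContMDiff 𝓘(ℝ, F) (𝓘(ℝ, F).prod 𝓘(ℝ, F →L[ℝ] F →L[ℝ] ℝ)) ∞
    (fun y ↦ TotalSpace.mk' (F →L[ℝ] F →L[ℝ] ℝ)
      (E := fun y : N ↦ TangentSpace 𝓘(ℝ, F) y →L[ℝ] TangentSpace 𝓘(ℝ, F) y →L[ℝ] ℝ) y (form y))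
  /-- the index of the metric -/
  index : ℕ
  isGreatest_index : ∀ y : N, IsGreatest
    {k : ℕ | ∃ W : Submodule ℝ (TangentSpace 𝓘(ℝ, F) y),
      Module.finrank ℝ W = k ∧ ∀ w ∈ W, w ≠ 0 → form y w w < 0} index

/-- The metric at a point as a bilinear form. -/
def SemiRiemannianMetric.bilin (g : SemiRiemannianMetric F N) (y : N) :
    LinearMap.BilinForm ℝ (TangentSpace 𝓘(ℝ, F) y) :=
  LinearMap.mk₂ ℝ (fun v w ↦ g.form y v w) (by simp) (by simp) (by simp) (by simp)

/-- A metallic structure with parameters `p`, `q` on a semi-Riemannian manifold: a smooth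
`(1,1)`-tensor field with `J² = p J + q I` for which the metric is `J`-compatible. -/
structure MetallicStructure (g : SemiRiemannianMetric F N) (p q : ℕ) where
  /-- the endomorphism of each tangent space -/
  endo : ∀ y : N, TangentSpace 𝓘(ℝ, F) y →L[ℝ] TangentSpace 𝓘(ℝ, F) y
  contMDiff : ContMDiff 𝓘(ℝ, F) (𝓘(ℝ, F).prod 𝓘(ℝ, F →L[ℝ] F)) ∞
    (fun y ↦ TotalSpace.mk' (F →L[ℝ] F)
      (E := fun y : N ↦ TangentSpace 𝓘(ℝ, F) y →L[ℝ] TangentSpace 𝓘(ℝ, F) y) y (endo y))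
  sq : ∀ (y : N) (v : TangentSpace 𝓘(ℝ, F) y),
    endo y (endo y v) = (p : ℝ) • endo y v + (q : ℝ) • v
  compatible : ∀ (y : N) (v w : TangentSpace 𝓘(ℝ, F) y),
    g.form y v (endo y w) = g.form y (endo y v) w

/-- `nabla` is the Levi-Civita connection of `g`: it is torsion-free and metric. In Mathlib's
argument order, `nabla Y y u` is the derivative of the vector field `Y` at `y` in direction `u`. -/
structure IsLeviCivita [FiniteDimensional ℝ F] (g : SemiRiemannianMetric F N)
    (nabla : CovariantDerivative 𝓘(ℝ, F) F (TangentSpace 𝓘(ℝ, F) : N → Type _)) : Prop where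
  torsion_eq_zero : nabla.torsion = 0
  metric : ∀ (y : N) (Y Z : ∀ y : N, TangentSpace 𝓘(ℝ, F) y) (u : TangentSpace 𝓘(ℝ, F) y),
    MDiffAt (T% Y) y → MDiffAt (T% Z) y →
    mvfderiv 𝓘(ℝ, F) (fun z ↦ g.form z (Y z) (Z z)) y u =
      g.form y (nabla Y y u) (Z y) + g.form y (Y y) (nabla Z y u)

/-- The quarter symmetric non-metric connection `D_U V = ∇_U V + π(V) J U`, where `π` is the
1-form `π(V) = g(V, η) = g(η, V)`. -/
def quarterSymmetricConnection {g : SemiRiemannianMetric F N} {p q : ℕ}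
    (J : MetallicStructure g p q)
    (nabla : CovariantDerivative 𝓘(ℝ, F) F (TangentSpace 𝓘(ℝ, F) : N → Type _))
    (η : ∀ y : N, TangentSpace 𝓘(ℝ, F) y) :
    CovariantDerivative 𝓘(ℝ, F) F (TangentSpace 𝓘(ℝ, F) : N → Type _) :=
  nabla.addOneForm fun y ↦ (g.form y (η y)).smulRight (J.endo y)

end Ambient

/-! ### Vector fields along a map -/

section Along

variable {E : Type*} [NormedAddCommGroup E] [NormedSpace ℝ E]
  {F : Type*} [NormedAddCommGroup F] [NormedSpace ℝ F]
  {M : Type*} [TopologicalSpace M] [ChartedSpace E M]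
  {N : Type*} [TopologicalSpace N] [ChartedSpace F N] [IsManifold 𝓘(ℝ, F) ∞ N]

variable (E) in
/-- `V` is a smooth section of the family `W` of subspaces of the tangent spaces of `N` along
`ι : M → N`. -/
structure IsSection (ι : M → N) (W : ∀ x : M, Submodule ℝ (TangentSpace 𝓘(ℝ, F) (ι x)))
    (V : ∀ x : M, TangentSpace 𝓘(ℝ, F) (ι x)) : Prop where
  contMDiff : ContMDiff 𝓘(ℝ, E) 𝓘(ℝ, F).tangent ∞
    (fun x ↦ (⟨ι x, V x⟩ : TangentBundle 𝓘(ℝ, F) N))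
  mem : ∀ x, V x ∈ W x

variable (E) in
/-- `W` is a smooth vector subbundle of `ι^* TN`: it has a smooth frame near every point. -/
def IsSmoothSubbundle (ι : M → N)
    (W : ∀ x : M, Submodule ℝ (TangentSpace 𝓘(ℝ, F) (ι x))) : Prop :=
  ∀ x₀ : M, ∃ (k : ℕ) (s : Fin k → ∀ x : M, TangentSpace 𝓘(ℝ, F) (ι x)),
    (∀ i, ContMDiffAt 𝓘(ℝ, E) 𝓘(ℝ, F).tangent ∞
      (fun x ↦ (⟨ι x, s i x⟩ : TangentBundle 𝓘(ℝ, F) N)) x₀) ∧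
    ∀ᶠ x in 𝓝 x₀, LinearIndependent ℝ (fun i ↦ s i x) ∧
      Submodule.span ℝ (Set.range fun i ↦ s i x) = W x

/-- The derivative `D_u V` at `x` of a vector field `V` along `ι` in the direction `u ∈ T_x M`, that
is, the pullback of the connection `D` to `ι^* TN`. In the trivialization `e` of `TN` around `ι x`
it is `dV(u) + Γ(dι u, V)`: the first summand differentiates the components of `V`, the second is
the `D`-derivative of the vector field on `N` with constant components `e(V x)`. -/
def derivAlong (D : CovariantDerivative 𝓘(ℝ, F) F (TangentSpace 𝓘(ℝ, F) : N → Type _))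
    (ι : M → N) (V : ∀ x : M, TangentSpace 𝓘(ℝ, F) (ι x)) (x : M) (u : TangentSpace 𝓘(ℝ, E) x) :
    TangentSpace 𝓘(ℝ, F) (ι x) :=
  (trivializationAt F (TangentSpace 𝓘(ℝ, F) : N → Type _) (ι x)).symm (ι x)
      (mvfderiv 𝓘(ℝ, E) (fun z : M ↦
        (trivializationAt F (TangentSpace 𝓘(ℝ, F) : N → Type _) (ι x) ⟨ι z, V z⟩).2) x u)
    + D (FiberBundle.extend F (V x)) (ι x) (mfderiv 𝓘(ℝ, E) 𝓘(ℝ, F) ι x u)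

end Along

/-! ### Lightlike submanifolds -/

section Lightlike

variable {E : Type*} [NormedAddCommGroup E] [NormedSpace ℝ E]
  {F : Type*} [NormedAddCommGroup F] [NormedSpace ℝ F]
  {M : Type*} [TopologicalSpace M] [ChartedSpace E M]
  {N : Type*} [TopologicalSpace N] [ChartedSpace F N] [IsManifold 𝓘(ℝ, F) ∞ N]

variable (E F) in
/-- The tangent space of `M` at `x`, as a subspace of the tangent space of `N` at `ι x`. -/
def tangent (ι : M → N) (x : M) : Submodule ℝ (TangentSpace 𝓘(ℝ, F) (ι x)) :=
  LinearMap.range (mfderiv 𝓘(ℝ, E) 𝓘(ℝ, F) ι x).toLinearMap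

variable (E) in
/-- The normal space `T_x M^⊥`. -/
def normal (g : SemiRiemannianMetric F N) (ι : M → N) (x : M) :
    Submodule ℝ (TangentSpace 𝓘(ℝ, F) (ι x)) :=
  (g.bilin (ι x)).orthogonal (tangent E F ι x)

variable (E) in
/-- The radical distribution `Rad T_x M = T_x M ∩ T_x M^⊥`. -/
def rad (g : SemiRiemannianMetric F N) (ι : M → N) (x : M) :
    Submodule ℝ (TangentSpace 𝓘(ℝ, F) (ι x)) :=
  tangent E F ι x ⊓ normal E g ι x

variable (E) in
/-- An `r`-lightlike submanifold `(M, g, S(TM), S(TM^⊥))`, immersed by `ι`, with a lightlike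
transversal bundle `ltr(TM)`. -/
structure LightlikeSubmanifold (g : SemiRiemannianMetric F N) (ι : M → N) where
  isImmersion : IsImmersion 𝓘(ℝ, E) 𝓘(ℝ, F) ∞ ι
  /-- the rank of the radical distribution -/
  r : ℕ
  r_pos : 0 < r
  finrank_rad : ∀ x, Module.finrank ℝ (rad E g ι x) = r
  /-- the screen distribution `S(TM)` -/
  screen : ∀ x : M, Submodule ℝ (TangentSpace 𝓘(ℝ, F) (ι x))
  screen_smooth : IsSmoothSubbundle E ι screen
  screen_disjoint : ∀ x, Disjoint (rad E g ι x) (screen x)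
  screen_sup : ∀ x, rad E g ι x ⊔ screen x = tangent E F ι x
  /-- the screen transversal bundle `S(TM^⊥)` -/
  screenTr : ∀ x : M, Submodule ℝ (TangentSpace 𝓘(ℝ, F) (ι x))
  screenTr_smooth : IsSmoothSubbundle E ι screenTr
  screenTr_disjoint : ∀ x, Disjoint (rad E g ι x) (screenTr x)
  screenTr_sup : ∀ x, rad E g ι x ⊔ screenTr x = normal E g ι x
  /-- the lightlike transversal bundle `ltr(TM)`: a totally null complement of `Rad(TM)` in the
  orthogonal complement of `S(TM^⊥)` in `S(TM)^⊥` -/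
  ltr : ∀ x : M, Submodule ℝ (TangentSpace 𝓘(ℝ, F) (ι x))
  ltr_smooth : IsSmoothSubbundle E ι ltr
  ltr_disjoint : ∀ x, Disjoint (rad E g ι x) (ltr x)
  ltr_sup : ∀ x, rad E g ι x ⊔ ltr x =
    (g.bilin (ι x)).orthogonal (screen x) ⊓ (g.bilin (ι x)).orthogonal (screenTr x)
  ltr_null : ∀ x, ∀ v ∈ ltr x, ∀ w ∈ ltr x, g.form (ι x) v w = 0

namespace LightlikeSubmanifold

variable {g : SemiRiemannianMetric F N} {ι : M → N} (L : LightlikeSubmanifold E g ι)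

/-- The transversal bundle `tr(TM) = ltr(TM) ⊕ S(TM^⊥)`. -/
def tr (x : M) : Submodule ℝ (TangentSpace 𝓘(ℝ, F) (ι x)) := L.ltr x ⊔ L.screenTr x

variable [FiniteDimensional ℝ F]

/-- `T_{ι x} N = S(TM) ⊕ (Rad(TM) ⊕ tr(TM))`. -/
theorem isCompl_screen (x : M) : IsCompl (L.screen x) (rad E g ι x ⊔ L.tr x) := by
  have : FiniteDimensional ℝ (TangentSpace 𝓘(ℝ, F) (ι x)) := inferInstanceAs (FiniteDimensional ℝ F)
  have hrefl : (g.bilin (ι x)).IsRefl := fun v w h ↦ (g.symm (ι x) w v).trans h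
  have hnd : (g.bilin (ι x)).Nondegenerate :=
    hrefl.nondegenerate_iff_separatingLeft.mpr fun v hv ↦ g.nondegenerate (ι x) v hv
  have hsT : L.screen x ≤ tangent E F ι x := L.screen_sup x ▸ le_sup_right
  have hqT : L.screenTr x ≤ normal E g ι x := L.screenTr_sup x ▸ le_sup_right
  have hsq : L.screenTr x ≤ (g.bilin (ι x)).orthogonal (L.screen x) := fun v hv w hw ↦
    hqT hv w (hsT hw)
  have hrs : rad E g ι x ≤ (g.bilin (ι x)).orthogonal (L.screen x) := fun v hv w hw ↦
    hv.2 w (hsT hw)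
  have hls : L.ltr x ≤ (g.bilin (ι x)).orthogonal (L.screen x) :=
    (le_sup_right.trans (L.ltr_sup x).le).trans inf_le_left
  have hds : Disjoint (L.screen x) ((g.bilin (ι x)).orthogonal (L.screen x)) := by
    rw [Submodule.disjoint_def]
    intro v hv hv'
    refine Submodule.disjoint_def.mp (L.screen_disjoint x) v ⟨hsT hv, fun w hw ↦ ?_⟩ hv
    rw [← L.screen_sup x] at hw
    obtain ⟨a, ha, b, hb, rfl⟩ := Submodule.mem_sup.mp hw
    have h1 : g.bilin (ι x) a v = 0 := hrefl _ _ (ha.2 v (hsT hv))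
    have h2 : g.bilin (ι x) b v = 0 := hv' b hb
    change g.bilin (ι x) (a + b) v = 0
    rw [map_add, LinearMap.add_apply, h1, h2, add_zero]
  have hdq : Disjoint (L.screenTr x) ((g.bilin (ι x)).orthogonal (L.screenTr x)) := by
    rw [Submodule.disjoint_def]
    intro v hv hv'
    have hvT : v ∈ tangent E F ι x := by
      rw [← LinearMap.BilinForm.orthogonal_orthogonal hnd hrefl (tangent E F ι x)]
      intro w hw
      change w ∈ normal E g ι x at hw
      rw [← L.screenTr_sup x] at hw
      obtain ⟨a, ha, b, hb, rfl⟩ := Submodule.mem_sup.mp hw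
      have h1 : g.bilin (ι x) a v = 0 := hqT hv a ha.1
      have h2 : g.bilin (ι x) b v = 0 := hv' b hb
      change g.bilin (ι x) (a + b) v = 0
      rw [map_add, LinearMap.add_apply, h1, h2, add_zero]
    exact Submodule.disjoint_def.mp (L.screenTr_disjoint x) v ⟨hvT, hqT hv⟩ hv
  have hcs := (LinearMap.BilinForm.isCompl_orthogonal_iff_disjoint hrefl).mpr hds
  have hcq := (LinearMap.BilinForm.isCompl_orthogonal_iff_disjoint hrefl).mpr hdq
  refine ⟨hcs.disjoint.mono_right (sup_le hrs (sup_le hls hsq)), ?_⟩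
  rw [codisjoint_iff, eq_top_iff]
  intro v _
  obtain ⟨s, hs, v', hv', rfl⟩ := Submodule.mem_sup.mp (hcs.sup_eq_top.ge (Submodule.mem_top (x := v)))
  obtain ⟨t, ht, w, hw, rfl⟩ := Submodule.mem_sup.mp (hcq.sup_eq_top.ge (Submodule.mem_top (x := v')))
  have hws : w ∈ (g.bilin (ι x)).orthogonal (L.screen x) := by
    have := Submodule.sub_mem _ hv' (hsq ht)
    rwa [add_sub_cancel_left] at this
  obtain ⟨a, ha, b, hb, rfl⟩ := Submodule.mem_sup.mp ((L.ltr_sup x).ge ⟨hws, hw⟩)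
  refine Submodule.add_mem_sup hs ?_
  have : t + (a + b) = a + (b + t) := by abel
  rw [this]
  exact Submodule.add_mem_sup ha (Submodule.add_mem_sup hb ht)

/-- `T_{ι x} N = TM ⊕ tr(TM)`. -/
theorem isCompl_tangent (x : M) : IsCompl (tangent E F ι x) (L.tr x) := by
  have hc := L.isCompl_screen x
  have hsT : L.screen x ≤ tangent E F ι x := L.screen_sup x ▸ le_sup_right
  have hqT : L.screenTr x ≤ normal E g ι x := L.screenTr_sup x ▸ le_sup_right
  have hrl : rad E g ι x ⊔ L.ltr x ≤ (g.bilin (ι x)).orthogonal (L.screenTr x) :=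
    (L.ltr_sup x).le.trans inf_le_right
  constructor
  · rw [Submodule.disjoint_def]
    intro v hv hv'
    rw [← L.screen_sup x] at hv
    obtain ⟨a, ha, s, hs, rfl⟩ := Submodule.mem_sup.mp hv
    have hs0 : s = 0 := by
      refine Submodule.disjoint_def.mp hc.disjoint s hs ?_
      have := Submodule.sub_mem _ ((le_sup_right : L.tr x ≤ rad E g ι x ⊔ L.tr x) hv')
        ((le_sup_left : rad E g ι x ≤ rad E g ι x ⊔ L.tr x) ha)
      rwa [add_sub_cancel_left] at this
    subst hs0
    rw [add_zero] at hv' ⊢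
    obtain ⟨l, hl, t, ht, rfl⟩ := Submodule.mem_sup.mp hv'
    have ht0 : t ∈ rad E g ι x := by
      refine ⟨?_, hqT ht⟩
      have : FiniteDimensional ℝ (TangentSpace 𝓘(ℝ, F) (ι x)) :=
        inferInstanceAs (FiniteDimensional ℝ F)
      have hrefl : (g.bilin (ι x)).IsRefl := fun v w h ↦ (g.symm (ι x) w v).trans h
      have hnd : (g.bilin (ι x)).Nondegenerate :=
        hrefl.nondegenerate_iff_separatingLeft.mpr fun v hv ↦ g.nondegenerate (ι x) v hv
      rw [← LinearMap.BilinForm.orthogonal_orthogonal hnd hrefl (tangent E F ι x)]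
      intro w hw
      change w ∈ normal E g ι x at hw
      rw [← L.screenTr_sup x] at hw
      obtain ⟨b, hb, c, hcq, rfl⟩ := Submodule.mem_sup.mp hw
      have h1 : g.bilin (ι x) b t = 0 := hqT ht b hb.1
      have h2 : g.bilin (ι x) c t = 0 := by
        have e1 : g.bilin (ι x) c (l + t) = 0 := hrefl _ _ (hqT hcq (l + t) ha.1)
        have e2 : g.bilin (ι x) c l = 0 := hrl (Submodule.mem_sup_right hl) c hcq
        rw [map_add, e2, zero_add] at e1
        exact e1
      change g.bilin (ι x) (b + c) t = 0
      rw [map_add, LinearMap.add_apply, h1, h2, add_zero]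
    have ht1 : t = 0 := Submodule.disjoint_def.mp (L.screenTr_disjoint x) t ht0 ht
    subst ht1
    rw [add_zero] at ha ⊢
    exact Submodule.disjoint_def.mp (L.ltr_disjoint x) l ha hl
  · rw [codisjoint_iff, eq_top_iff, ← hc.sup_eq_top]
    refine sup_le (hsT.trans le_sup_left) (sup_le (inf_le_left.trans le_sup_left) le_sup_right)

/-- The projection of `T_{ι x} N` onto `TM` along `tr(TM)`. -/
def tangentProj (x : M) : TangentSpace 𝓘(ℝ, F) (ι x) →ₗ[ℝ] TangentSpace 𝓘(ℝ, F) (ι x) :=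
  Submodule.projection _ _ (L.isCompl_tangent x)

/-- The projection of `T_{ι x} N` onto `S(TM)` along `Rad(TM) ⊕ tr(TM)`. On `TM` it is the
projection onto `S(TM)` along `Rad(TM)`. -/
def screenProj (x : M) : TangentSpace 𝓘(ℝ, F) (ι x) →ₗ[ℝ] TangentSpace 𝓘(ℝ, F) (ι x) :=
  Submodule.projection _ _ (L.isCompl_screen x)

/-- The connection on `M` induced by a connection `D` on `N`: the `TM`-component of `D_u V` in the
Gauss formula. -/
def inducedDeriv (D : CovariantDerivative 𝓘(ℝ, F) F (TangentSpace 𝓘(ℝ, F) : N → Type _))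
    (V : ∀ x : M, TangentSpace 𝓘(ℝ, F) (ι x)) (x : M) (u : TangentSpace 𝓘(ℝ, E) x) :
    TangentSpace 𝓘(ℝ, F) (ι x) :=
  L.tangentProj x (derivAlong D ι V x u)

/-- The screen shape operator `A^*_V u`: minus the `S(TM)`-component of the induced derivative
`D_u V` of a section `V` of `Rad(TM)`. -/
def screenShape (D : CovariantDerivative 𝓘(ℝ, F) F (TangentSpace 𝓘(ℝ, F) : N → Type _))
    (V : ∀ x : M, TangentSpace 𝓘(ℝ, F) (ι x)) (x : M) (u : TangentSpace 𝓘(ℝ, E) x) :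
    TangentSpace 𝓘(ℝ, F) (ι x) :=
  -L.screenProj x (L.inducedDeriv D V x u)

/-- The submanifold is invariant: `J Rad(TM) = Rad(TM)` and `J S(TM) = S(TM)`. -/
structure IsInvariant {p q : ℕ} (J : MetallicStructure g p q) : Prop where
  map_rad : ∀ x, (rad E g ι x).map (J.endo (ι x)).toLinearMap = rad E g ι x
  map_screen : ∀ x, (L.screen x).map (J.endo (ι x)).toLinearMap = L.screen x

end LightlikeSubmanifold

variable [IsManifold 𝓘(ℝ, E) ∞ M]

/-- `U` is a smooth vector field on `M` lying in `Rad(TM)`. -/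
structure IsRadField (g : SemiRiemannianMetric F N) (ι : M → N)
    (U : ∀ x : M, TangentSpace 𝓘(ℝ, E) x) : Prop where
  contMDiff : ContMDiff 𝓘(ℝ, E) 𝓘(ℝ, E).tangent ∞
    (fun x ↦ (⟨x, U x⟩ : TangentBundle 𝓘(ℝ, E) M))
  mem : ∀ x, mfderiv 𝓘(ℝ, E) 𝓘(ℝ, F) ι x (U x) ∈ rad E g ι x

/-- `Rad(TM)` defines a totally geodesic foliation with respect to the connection induced by `D`:
it is involutive, and the induced derivative of a section of `Rad(TM)` in a direction of `Rad(TM)`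
lies in `Rad(TM)`. Sections of `Rad(TM)` that are differentiated are regarded as vector fields
along `ι`, those that give the direction as vector fields on `M`. -/
structure LightlikeSubmanifold.RadTotallyGeodesic [FiniteDimensional ℝ F]
    {g : SemiRiemannianMetric F N} {ι : M → N} (L : LightlikeSubmanifold E g ι)
    (D : CovariantDerivative 𝓘(ℝ, F) F (TangentSpace 𝓘(ℝ, F) : N → Type _)) : Prop where
  involutive : ∀ U V : ∀ x : M, TangentSpace 𝓘(ℝ, E) x, IsRadField g ι U → IsRadField g ι V →
    ∀ x, mfderiv 𝓘(ℝ, E) 𝓘(ℝ, F) ι x (VectorField.mlieBracket 𝓘(ℝ, E) U V x) ∈ rad E g ι x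
  inducedDeriv_mem : ∀ (U : ∀ x : M, TangentSpace 𝓘(ℝ, E) x)
    (V : ∀ x : M, TangentSpace 𝓘(ℝ, F) (ι x)), IsRadField g ι U → IsSection E ι (rad E g ι) V →
    ∀ x, L.inducedDeriv D V x (U x) ∈ rad E g ι x

end Lightlike

end LightlikeGeometry
end

open LightlikeGeometry

/-!
The screen shape operator `A^*_V U` vanishes exactly when the induced derivative `D_U V` lies in
`Rad(TM)`. Involutivity of `Rad(TM)` follows from the vanishing of all `A^*_V U`: the quarter
symmetric connection differs from the Levi-Civita connection by the term `π(V) J U`, which lies in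
`Rad(TM)` by invariance, and the pullback of the torsion-free Levi-Civita connection to `M` is
torsion-free (`derivAlong_sub_derivAlong`), so the `S(TM)`-component of
`[U, V] = ∇_U V - ∇_V U` vanishes. Hence `Rad(TM)` defines a totally geodesic foliation if and only
if `A^*` vanishes on it (`LightlikeSubmanifold.radTotallyGeodesic_iff`).

Both characterizations are then purely algebraic. The operator `A^*_V` is linear over constants in
`V`, so `J² = p J + q` gives `A^*_{J²V} = p A^*_{JV} + q A^*_V`
(`LightlikeSubmanifold.screenShape_endo_endo`). If `A^*_{JV} = c A^*_V` for all `V` in `Rad(TM)`,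
then also `A^*_{J²V} = c² A^*_V`, whence `(c² - p c - q) A^*_V = 0`. For `c = p` the factor is `-q`
and for `c = -p` it is `2 p² - q`, both nonzero under the hypotheses.
-/

namespace LightlikeGeometry

/-! ### The Lie bracket as a commutator of derivations -/

section Bracket

open VectorField

variable {E : Type*} [NormedAddCommGroup E] [NormedSpace ℝ E]
  {F : Type*} [NormedAddCommGroup F] [NormedSpace ℝ F]
  {M : Type*} [TopologicalSpace M] [ChartedSpace E M]

theorem mvfderiv_congr {f g : M → F} {x : M} (h : f =ᶠ[𝓝 x] g) :
    mvfderiv 𝓘(ℝ, E) f x = mvfderiv 𝓘(ℝ, E) g x := by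
  ext v
  simp only [mvfderiv, ContinuousLinearMap.comp_apply]
  exact congrArg (fun A : E →L[ℝ] F ↦ A v) h.mfderiv_eq

theorem mvfderiv_comp_extChartAt [IsManifold 𝓘(ℝ, E) 1 M] {k : E → F} {x z : M}
    (hz : z ∈ (chartAt E x).source)
    (hk : DifferentiableAt ℝ k (extChartAt 𝓘(ℝ, E) x z)) (u : TangentSpace 𝓘(ℝ, E) z) :
    mvfderiv 𝓘(ℝ, E) (fun z ↦ k (extChartAt 𝓘(ℝ, E) x z)) z u =
      fderiv ℝ k (extChartAt 𝓘(ℝ, E) x z)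
        (mfderiv 𝓘(ℝ, E) 𝓘(ℝ, E) (extChartAt 𝓘(ℝ, E) x) z u) := by
  have h := mfderiv_comp_apply (I := 𝓘(ℝ, E)) (I' := 𝓘(ℝ, E)) (I'' := 𝓘(ℝ, F)) z
    hk.mdifferentiableAt (mdifferentiableAt_extChartAt hz) u
  rw [mfderiv_eq_fderiv] at h
  exact h

/-- The vector field `V` read in the preferred chart at `x`, as a map `E → E`: the pullback of `V`
under the inverse of the chart. It is meaningful on the target of the chart only. -/
noncomputable def chartField (x : M) (V : ∀ z : M, TangentSpace 𝓘(ℝ, E) z) : E → E :=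
  mpullbackWithin 𝓘(ℝ, E) 𝓘(ℝ, E) (extChartAt 𝓘(ℝ, E) x).symm V (Set.range 𝓘(ℝ, E))

/-- The lemma `ContinuousLinearMap.IsInvertible.inverse_apply_eq` on the model space `E`. It applies
to derivatives of charts, whose domain and codomain are fibers of different tangent bundles, all of
them definitionally equal to `E`. -/
theorem inverse_apply_eq_of_model {A : E →L[ℝ] E} (hA : A.IsInvertible) {v w : E} :
    A.inverse v = w ↔ v = A w :=
  hA.inverse_apply_eq

theorem chartField_extChartAt [IsManifold 𝓘(ℝ, E) 1 M] {x z : M}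
    (hz : z ∈ (chartAt E x).source) (V : ∀ z : M, TangentSpace 𝓘(ℝ, E) z) :
    chartField x V (extChartAt 𝓘(ℝ, E) x z) =
      mfderiv 𝓘(ℝ, E) 𝓘(ℝ, E) (extChartAt 𝓘(ℝ, E) x) z (V z) := by
  have hz' : z ∈ (extChartAt 𝓘(ℝ, E) x).source := by simpa using hz
  have hy := (extChartAt 𝓘(ℝ, E) x).map_source hz'
  have hinv := isInvertible_mfderivWithin_extChartAt_symm (I := 𝓘(ℝ, E)) hy
  have h1 := mfderivWithin_extChartAt_symm_comp_mfderiv_extChartAt' (I := 𝓘(ℝ, E)) hz'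
  unfold chartField
  rw [mpullbackWithin_apply]
  have hl : (extChartAt 𝓘(ℝ, E) x).symm (extChartAt 𝓘(ℝ, E) x z) = z :=
    (extChartAt 𝓘(ℝ, E) x).left_inv hz'
  have hVz : (V ((extChartAt 𝓘(ℝ, E) x).symm (extChartAt 𝓘(ℝ, E) x z)) : E) = V z :=
    congrArg (fun y ↦ (V y : E)) hl
  exact ((inverse_apply_eq_of_model (E := E) hinv).mpr
      (congrArg (fun A : E →L[ℝ] E ↦ A _) h1).symm).trans
    (congrArg (mfderiv 𝓘(ℝ, E) 𝓘(ℝ, E) (extChartAt 𝓘(ℝ, E) x) z : E →L[ℝ] E) hVz)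

/-- The Lie bracket acts on vector-valued functions as the commutator of derivations:
`[U, V] f = U (V f) - V (U f)`. In a chart the second derivatives of `f` cancel by symmetry. -/
theorem mvfderiv_mlieBracket [CompleteSpace E] [IsManifold 𝓘(ℝ, E) 2 M] {f : M → F} {x : M}
    (hf : ContMDiffAt 𝓘(ℝ, E) 𝓘(ℝ, F) 2 f x) {U V : ∀ z : M, TangentSpace 𝓘(ℝ, E) z}
    (hU : MDiffAt (T% U) x) (hV : MDiffAt (T% V) x) :
    mvfderiv 𝓘(ℝ, E) f x (mlieBracket 𝓘(ℝ, E) U V x) =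
      mvfderiv 𝓘(ℝ, E) (fun z ↦ mvfderiv 𝓘(ℝ, E) f z (V z)) x (U x) -
        mvfderiv 𝓘(ℝ, E) (fun z ↦ mvfderiv 𝓘(ℝ, E) f z (U z)) x (V x) := by
  have : IsManifold 𝓘(ℝ, E) 1 M := .of_le (n := 2) (by norm_num)
  set φ := extChartAt 𝓘(ℝ, E) x with hφ
  let f' : E → F := fun w ↦ f (φ.symm w)
  have hf' : ContDiffAt ℝ 2 f' (φ x) := by
    have := (contMDiffAt_iff.mp hf).2
    rw [ModelWithCorners.range_eq_univ] at this
    exact contDiffWithinAt_univ.mp this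
  have hff : ∀ᶠ z in 𝓝 x, f z = f' (φ z) := by
    filter_upwards [extChartAt_source_mem_nhds (I := 𝓘(ℝ, E)) x] with z hz
    simp only [f', hφ, (extChartAt 𝓘(ℝ, E) x).left_inv hz]
  -- `W f` read in the chart is the derivative of `f'` along the chart expression of `W`.
  have hd : ∀ W : ∀ z : M, TangentSpace 𝓘(ℝ, E) z, ∀ᶠ z in 𝓝 x,
      mvfderiv 𝓘(ℝ, E) f z (W z) = fderiv ℝ f' (φ z) (chartField x W (φ z)) := by
    intro W
    have h1 : ∀ᶠ w in 𝓝 (φ x), DifferentiableAt ℝ f' w :=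
      (hf'.eventually (by simp)).mono fun w hw ↦ hw.differentiableAt (by norm_num)
    filter_upwards [extChartAt_source_mem_nhds (I := 𝓘(ℝ, E)) x, hff.eventually_nhds,
      (continuousAt_extChartAt (I := 𝓘(ℝ, E)) x).eventually h1] with z hz hz2 hz3
    have hz' : z ∈ (chartAt E x).source := by simpa using hz
    rw [chartField_extChartAt hz', ← mvfderiv_comp_extChartAt hz' hz3, mvfderiv_congr hz2]
  have hdd : ∀ W : ∀ z : M, TangentSpace 𝓘(ℝ, E) z, MDiffAt (T% W) x →
      DifferentiableAt ℝ (chartField x W) (φ x) := by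
    intro W hW
    have := hW.mdifferentiableWithinAt.differentiableWithinAt_mpullbackWithin_vectorField
      (s := Set.univ)
    rw [Set.preimage_univ, Set.univ_inter, ModelWithCorners.range_eq_univ] at this
    rw [chartField, ModelWithCorners.range_eq_univ]
    exact differentiableWithinAt_univ.mp this
  have hx := mem_chart_source E x
  have hfd : DifferentiableAt ℝ (fderiv ℝ f') (φ x) :=
    (hf'.fderiv_right (m := 1) (by norm_num)).differentiableAt (by norm_num)
  have hk : ∀ W : ∀ z : M, TangentSpace 𝓘(ℝ, E) z, MDiffAt (T% W) x → ∀ u,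
      mvfderiv 𝓘(ℝ, E) (fun z ↦ mvfderiv 𝓘(ℝ, E) f z (W z)) x u =
        fderiv ℝ (fun w ↦ fderiv ℝ f' w (chartField x W w)) (φ x)
          (mfderiv 𝓘(ℝ, E) 𝓘(ℝ, E) φ x u) := by
    intro W hW u
    rw [← mvfderiv_comp_extChartAt hx (hfd.clm_apply (hdd W hW)), mvfderiv_congr (hd W)]
  rw [hk V hV, hk U hU, ← chartField_extChartAt hx, ← chartField_extChartAt hx,
    fderiv_clm_apply hfd (hdd U hU), fderiv_clm_apply hfd (hdd V hV)]
  -- The product rule leaves the second derivative of `f'`, which cancels by symmetry, and the bracket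
  -- of the chart expressions of `U` and `V`.
  have hsymm : IsSymmSndFDerivAt ℝ f' (φ x) := hf'.isSymmSndFDerivAt (by simp)
  have hbr : mfderiv 𝓘(ℝ, E) 𝓘(ℝ, E) φ x (mlieBracket 𝓘(ℝ, E) U V x) =
      lieBracket ℝ (chartField x U) (chartField x V) (φ x) := by
    have h := mlieBracketWithin_apply (I := 𝓘(ℝ, E)) (V := U) (W := V) (s := Set.univ) (x₀ := x)
    rw [Set.preimage_univ, Set.univ_inter] at h
    rw [← mlieBracketWithin_univ, h, ← lieBracketWithin_univ,
      ← ModelWithCorners.range_eq_univ 𝓘(ℝ, E)]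
    exact ((inverse_apply_eq_of_model (E := E) (isInvertible_mfderiv_extChartAt (I := 𝓘(ℝ, E))
      (mem_extChartAt_source x))).mp rfl).symm
  have hfb : mvfderiv 𝓘(ℝ, E) f x (mlieBracket 𝓘(ℝ, E) U V x) =
      fderiv ℝ f' (φ x) (mfderiv 𝓘(ℝ, E) 𝓘(ℝ, E) φ x (mlieBracket 𝓘(ℝ, E) U V x)) := by
    rw [← mvfderiv_comp_extChartAt hx (hf'.differentiableAt (by norm_num)), mvfderiv_congr hff]
  have hs := hsymm (chartField x U (φ x)) (chartField x V (φ x))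
  rw [hfb, hbr, lieBracket]
  simp only [add_apply, ContinuousLinearMap.comp_apply, ContinuousLinearMap.flip_apply, map_sub,
    ← hφ]
  rw [hs]
  abel

end Bracket

/-! ### The derivative of vector fields along a map -/

section AlongLemmas

open VectorField FiberBundle

variable {E : Type*} [NormedAddCommGroup E] [NormedSpace ℝ E]
  {F : Type*} [NormedAddCommGroup F] [NormedSpace ℝ F]
  {M : Type*} [TopologicalSpace M] [ChartedSpace E M]
  {N : Type*} [TopologicalSpace N] [ChartedSpace F N] [IsManifold 𝓘(ℝ, F) ∞ N]

/-- The two sides agree only near `y`: outside the base set of the trivialization at `y`, `extend`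
takes an arbitrary value, which need not be additive. -/
theorem extend_add_eventuallyEq {y : N} (v w : TangentSpace 𝓘(ℝ, F) y) :
    ∀ᶠ z in 𝓝 y, extend F (v + w) z = (extend F v + extend F w) z := by
  set e := trivializationAt F (TangentSpace 𝓘(ℝ, F) : N → Type _) y
  filter_upwards [e.open_baseSet.mem_nhds (mem_baseSet_trivializationAt' y)] with z hz
  have h := (e.linear ℝ (mem_baseSet_trivializationAt' y)).map_add v w
  change e.symm z (e ⟨y, v + w⟩).2 = e.symm z (e ⟨y, v⟩).2 + e.symm z (e ⟨y, w⟩).2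
  rw [h, ← e.coe_symmₗ (R := ℝ) hz, map_add]

theorem extend_smul_eventuallyEq {y : N} (c : ℝ) (v : TangentSpace 𝓘(ℝ, F) y) :
    ∀ᶠ z in 𝓝 y, extend F (c • v) z = (c • extend F v) z := by
  set e := trivializationAt F (TangentSpace 𝓘(ℝ, F) : N → Type _) y
  filter_upwards [e.open_baseSet.mem_nhds (mem_baseSet_trivializationAt' y)] with z hz
  have h := (e.linear ℝ (mem_baseSet_trivializationAt' y)).map_smul c v
  change e.symm z (e ⟨y, c • v⟩).2 = c • e.symm z (e ⟨y, v⟩).2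
  rw [h, ← e.coe_symmₗ (R := ℝ) hz, map_smul]

section CovariantDerivative

variable (D : CovariantDerivative 𝓘(ℝ, F) F (TangentSpace 𝓘(ℝ, F) : N → Type _))

theorem covariantDerivative_extend_add {y : N} (v w : TangentSpace 𝓘(ℝ, F) y) :
    D (extend F (v + w)) y = D (extend F v) y + D (extend F w) y := by
  have hv := mdifferentiableAt_extend 𝓘(ℝ, F) F v
  have hw := mdifferentiableAt_extend 𝓘(ℝ, F) F w
  rw [← D.isCovariantDerivativeOn.add hv hw]
  exact D.isCovariantDerivativeOn.congr_of_eventuallyEq (mdifferentiableAt_extend _ _ _)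
    (mdifferentiableAt_add_section hv hw) Filter.univ_mem (extend_add_eventuallyEq v w)

theorem covariantDerivative_extend_smul {y : N} (c : ℝ) (v : TangentSpace 𝓘(ℝ, F) y) :
    D (extend F (c • v)) y = c • D (extend F v) y := by
  have hv := mdifferentiableAt_extend 𝓘(ℝ, F) F v
  rw [← D.isCovariantDerivativeOn.smul_const c hv]
  exact D.isCovariantDerivativeOn.congr_of_eventuallyEq (mdifferentiableAt_extend _ _ _)
    hv.smul_const_section Filter.univ_mem (extend_smul_eventuallyEq c v)

end CovariantDerivative

theorem mdifferentiableAt_trivializationAt_snd {ι : M → N}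
    {V : ∀ x : M, TangentSpace 𝓘(ℝ, F) (ι x)} {x : M}
    (hV : ContMDiffAt 𝓘(ℝ, E) 𝓘(ℝ, F).tangent ∞
      (fun x ↦ (⟨ι x, V x⟩ : TangentBundle 𝓘(ℝ, F) N)) x) :
    MDifferentiableAt 𝓘(ℝ, E) 𝓘(ℝ, F) (fun z : M ↦
        (trivializationAt F (TangentSpace 𝓘(ℝ, F) : N → Type _) (ι x) ⟨ι z, V z⟩).2) x :=
  ((mdifferentiableAt_totalSpace _ _).mp (hV.mdifferentiableAt (by simp))).2

theorem trivializationAt_snd_smul {ι : M → N} {x : M} (hι : ContinuousAt ι x) (c : ℝ)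
    (V : ∀ x : M, TangentSpace 𝓘(ℝ, F) (ι x)) :
    (fun z ↦ (trivializationAt F (TangentSpace 𝓘(ℝ, F) : N → Type _) (ι x) ⟨ι z, c • V z⟩).2)
      =ᶠ[𝓝 x] fun z ↦
        c • (trivializationAt F (TangentSpace 𝓘(ℝ, F) : N → Type _) (ι x) ⟨ι z, V z⟩).2 := by
  set e := trivializationAt F (TangentSpace 𝓘(ℝ, F) : N → Type _) (ι x)
  filter_upwards [hι.eventually (e.open_baseSet.mem_nhds (mem_baseSet_trivializationAt' (ι x)))]
    with z hz
  exact (e.linear ℝ hz).map_smul c (V z)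

theorem derivAlong_add (D : CovariantDerivative 𝓘(ℝ, F) F (TangentSpace 𝓘(ℝ, F) : N → Type _))
    {ι : M → N} {V W : ∀ x : M, TangentSpace 𝓘(ℝ, F) (ι x)} {x : M}
    (hι : ContinuousAt ι x)
    (hV : ContMDiffAt 𝓘(ℝ, E) 𝓘(ℝ, F).tangent ∞
      (fun x ↦ (⟨ι x, V x⟩ : TangentBundle 𝓘(ℝ, F) N)) x)
    (hW : ContMDiffAt 𝓘(ℝ, E) 𝓘(ℝ, F).tangent ∞
      (fun x ↦ (⟨ι x, W x⟩ : TangentBundle 𝓘(ℝ, F) N)) x) (u : TangentSpace 𝓘(ℝ, E) x) :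
    derivAlong D ι (fun z ↦ V z + W z) x u = derivAlong D ι V x u + derivAlong D ι W x u := by
  set e := trivializationAt F (TangentSpace 𝓘(ℝ, F) : N → Type _) (ι x) with he
  have hlin : (fun z ↦ (e ⟨ι z, V z + W z⟩).2) =ᶠ[𝓝 x]
      fun z ↦ (e ⟨ι z, V z⟩).2 + (e ⟨ι z, W z⟩).2 := by
    filter_upwards [hι.eventually (e.open_baseSet.mem_nhds (mem_baseSet_trivializationAt' (ι x)))]
      with z hz
    exact (e.linear ℝ hz).map_add (V z) (W z)
  unfold derivAlong
  rw [← he, mvfderiv_congr hlin, mvfderiv_fun_add (mdifferentiableAt_trivializationAt_snd hV)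
    (mdifferentiableAt_trivializationAt_snd hW), covariantDerivative_extend_add,
    ← e.coe_symmₗ (R := ℝ) (mem_baseSet_trivializationAt' (ι x)), add_apply, add_apply, map_add]
  abel

theorem IsSection.const_smul {ι : M → N}
    {W : ∀ x : M, Submodule ℝ (TangentSpace 𝓘(ℝ, F) (ι x))} (c : ℝ)
    {V : ∀ x : M, TangentSpace 𝓘(ℝ, F) (ι x)} (hV : IsSection E ι W V) :
    IsSection E ι W (fun z ↦ c • V z) where
  contMDiff x := by
    have h := contMDiffAt_totalSpace.mp (hV.contMDiff x)
    have hc : ContMDiff 𝓘(ℝ, F) 𝓘(ℝ, F) ∞ (fun y : F ↦ c • y) := (contDiff_const_smul c).contMDiff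
    exact contMDiffAt_totalSpace.mpr ⟨h.1, (hc.contMDiffAt.comp x h.2).congr_of_eventuallyEq
      (trivializationAt_snd_smul h.1.continuousAt c V)⟩
  mem x := (W x).smul_mem c (hV.mem x)

theorem derivAlong_smul (D : CovariantDerivative 𝓘(ℝ, F) F (TangentSpace 𝓘(ℝ, F) : N → Type _))
    {ι : M → N} (c : ℝ) {V : ∀ x : M, TangentSpace 𝓘(ℝ, F) (ι x)} {x : M}
    (hι : ContinuousAt ι x)
    (hV : ContMDiffAt 𝓘(ℝ, E) 𝓘(ℝ, F).tangent ∞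
      (fun x ↦ (⟨ι x, V x⟩ : TangentBundle 𝓘(ℝ, F) N)) x) (u : TangentSpace 𝓘(ℝ, E) x) :
    derivAlong D ι (fun z ↦ c • V z) x u = c • derivAlong D ι V x u := by
  set e := trivializationAt F (TangentSpace 𝓘(ℝ, F) : N → Type _) (ι x) with he
  have hlin : (fun z ↦ (e ⟨ι z, c • V z⟩).2) =ᶠ[𝓝 x] fun z ↦ c • (e ⟨ι z, V z⟩).2 :=
    trivializationAt_snd_smul hι c V
  have hd : mvfderiv 𝓘(ℝ, E) (fun z ↦ c • (e ⟨ι z, V z⟩).2) x =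
      c • mvfderiv 𝓘(ℝ, E) (fun z ↦ (e ⟨ι z, V z⟩).2) x := by
    rw [mvfderiv_fun_smul (a := fun _ ↦ c) mdifferentiableAt_const
      (mdifferentiableAt_trivializationAt_snd hV)]
    ext v
    simp [mvfderiv_const, ← he]
  unfold derivAlong
  rw [← he, mvfderiv_congr hlin, hd, covariantDerivative_extend_smul,
    ← e.coe_symmₗ (R := ℝ) (mem_baseSet_trivializationAt' (ι x)), smul_apply, smul_apply, map_smul,
    smul_add]

/-- Along `ι`, passing from `∇` to the quarter symmetric connection adds `π(V) J (dι u)`. -/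
theorem derivAlong_quarterSymmetricConnection {g : SemiRiemannianMetric F N} {p q : ℕ}
    (J : MetallicStructure g p q)
    (nabla : CovariantDerivative 𝓘(ℝ, F) F (TangentSpace 𝓘(ℝ, F) : N → Type _))
    (η : ∀ y : N, TangentSpace 𝓘(ℝ, F) y) (ι : M → N)
    (V : ∀ x : M, TangentSpace 𝓘(ℝ, F) (ι x)) (x : M) (u : TangentSpace 𝓘(ℝ, E) x) :
    derivAlong (quarterSymmetricConnection J nabla η) ι V x u = derivAlong nabla ι V x u +
      g.form (ι x) (η (ι x)) (V x) • J.endo (ι x) (mfderiv 𝓘(ℝ, E) 𝓘(ℝ, F) ι x u) := by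
  have h : quarterSymmetricConnection J nabla η (extend F (V x)) (ι x)
      (mfderiv 𝓘(ℝ, E) 𝓘(ℝ, F) ι x u) = nabla (extend F (V x)) (ι x)
      (mfderiv 𝓘(ℝ, E) 𝓘(ℝ, F) ι x u) + g.form (ι x) (η (ι x)) (extend F (V x) (ι x)) •
        J.endo (ι x) (mfderiv 𝓘(ℝ, E) 𝓘(ℝ, F) ι x u) := rfl
  rw [extend_apply_self] at h
  unfold derivAlong
  rw [h, add_assoc]

/-- A metallic structure maps smooth sections of a family of subspaces it preserves to smooth
sections of this family. -/
theorem MetallicStructure.isSection_endo {g : SemiRiemannianMetric F N} {p q : ℕ}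
    (J : MetallicStructure g p q) {ι : M → N} (hι : ContMDiff 𝓘(ℝ, E) 𝓘(ℝ, F) ∞ ι)
    {W : ∀ x : M, Submodule ℝ (TangentSpace 𝓘(ℝ, F) (ι x))}
    (hW : ∀ x, (W x).map (J.endo (ι x)).toLinearMap ≤ W x)
    {V : ∀ x : M, TangentSpace 𝓘(ℝ, F) (ι x)} (hV : IsSection E ι W V) :
    IsSection E ι W (fun z ↦ J.endo (ι z) (V z)) where
  contMDiff x := ContMDiffAt.clm_bundle_apply (E₁ := (TangentSpace 𝓘(ℝ, F) : N → Type _))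
    (E₂ := (TangentSpace 𝓘(ℝ, F) : N → Type _))
    ((J.contMDiff.comp hι) x) (hV.contMDiff x)
  mem x := hW x (Submodule.mem_map_of_mem (hV.mem x))

/-- The trivialization of the tangent bundle at `y` is the derivative of the preferred chart. -/
theorem trivializationAt_snd_eq_mvfderiv {y z : N} (hz : z ∈ (chartAt F y).source)
    (v : TangentSpace 𝓘(ℝ, F) z) :
    (trivializationAt F (TangentSpace 𝓘(ℝ, F) : N → Type _) y ⟨z, v⟩).2 =
      mvfderiv 𝓘(ℝ, F) (extChartAt 𝓘(ℝ, F) y) z v := by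
  have h := TangentBundle.continuousLinearMapAt_trivializationAt (I := 𝓘(ℝ, F)) hz
  have hz' : z ∈ (trivializationAt F (TangentSpace 𝓘(ℝ, F) : N → Type _) y).baseSet := hz
  have h2 := congrArg (fun A : F →L[ℝ] F ↦ A v) h
  exact (Trivialization.continuousLinearMapAt_apply_of_mem (R := ℝ) _ hz' v).symm.trans h2

theorem mvfderiv_extChartAt_extend {y : N} (v : TangentSpace 𝓘(ℝ, F) y) :
    (fun z ↦ mvfderiv 𝓘(ℝ, F) (extChartAt 𝓘(ℝ, F) y) z (extend F v z)) =ᶠ[𝓝 y] fun _ ↦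
      (trivializationAt F (TangentSpace 𝓘(ℝ, F) : N → Type _) y ⟨y, v⟩).2 := by
  filter_upwards [(chartAt F y).open_source.mem_nhds (mem_chart_source F y)] with z hz
  rw [← trivializationAt_snd_eq_mvfderiv hz]
  have hz' : z ∈ (trivializationAt F (TangentSpace 𝓘(ℝ, F) : N → Type _) y).baseSet := hz
  have h := Trivialization.apply_mk_symm _ hz'
    (trivializationAt F (TangentSpace 𝓘(ℝ, F) : N → Type _) y ⟨y, v⟩).2
  exact (congrArg Prod.snd h :)

/-- The canonical extensions of two vectors at `y` have constant components in the chart at `y`, so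
they commute at `y`. -/
theorem mlieBracket_extend [CompleteSpace F] {y : N} (v w : TangentSpace 𝓘(ℝ, F) y) :
    mlieBracket 𝓘(ℝ, F) (extend F v) (extend F w) y = 0 := by
  have h := mvfderiv_mlieBracket (contMDiffAt_extChartAt (I := 𝓘(ℝ, F)) (x := y))
    (mdifferentiableAt_extend 𝓘(ℝ, F) F v) (mdifferentiableAt_extend 𝓘(ℝ, F) F w)
  rw [mvfderiv_congr (mvfderiv_extChartAt_extend v), mvfderiv_congr (mvfderiv_extChartAt_extend w),
    mvfderiv_const, mvfderiv_const, zero_apply, zero_apply, sub_zero,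
    ← trivializationAt_snd_eq_mvfderiv (mem_chart_source F y)] at h
  have h2 := Trivialization.symm_proj_apply
    (trivializationAt F (TangentSpace 𝓘(ℝ, F) : N → Type _) y)
    ⟨y, mlieBracket 𝓘(ℝ, F) (extend F v) (extend F w) y⟩ (mem_baseSet_trivializationAt' y)
  rw [h, ← Trivialization.coe_symmₗ (R := ℝ) _ (mem_baseSet_trivializationAt' y), map_zero] at h2
  exact h2.symm

/-- The pullback of a torsion-free connection to `ι^* TN` is torsion-free:
`D_U (dι V) - D_V (dι U) = dι [U, V]`. With `f` the map `ι` read in the chart at `ι x`, the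
components of `dι V` are `V f`, so the coordinate parts contribute `U (V f) - V (U f) = [U, V] f`,
while the connection parts cancel since constant-component fields commute. -/
theorem derivAlong_sub_derivAlong [FiniteDimensional ℝ F] [CompleteSpace E]
    [IsManifold 𝓘(ℝ, E) ∞ M]
    {D : CovariantDerivative 𝓘(ℝ, F) F (TangentSpace 𝓘(ℝ, F) : N → Type _)}
    (hD : D.torsion = 0) {ι : M → N} (hι : ContMDiff 𝓘(ℝ, E) 𝓘(ℝ, F) ∞ ι)
    {U V : ∀ x : M, TangentSpace 𝓘(ℝ, E) x} {x : M}
    (hU : MDiffAt (T% U) x) (hV : MDiffAt (T% V) x) :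
    derivAlong D ι (fun z ↦ mfderiv 𝓘(ℝ, E) 𝓘(ℝ, F) ι z (V z)) x (U x) -
      derivAlong D ι (fun z ↦ mfderiv 𝓘(ℝ, E) 𝓘(ℝ, F) ι z (U z)) x (V x) =
      mfderiv 𝓘(ℝ, E) 𝓘(ℝ, F) ι x (mlieBracket 𝓘(ℝ, E) U V x) := by
  set e := trivializationAt F (TangentSpace 𝓘(ℝ, F) : N → Type _) (ι x) with he
  set f : M → F := fun z ↦ extChartAt 𝓘(ℝ, F) (ι x) (ι z)
  have hf2 : ContMDiffAt 𝓘(ℝ, E) 𝓘(ℝ, F) 2 f x :=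
    (contMDiffAt_extChartAt (I := 𝓘(ℝ, F)) (x := ι x)).comp x
      ((hι x).of_le (ENat.LEInfty.out (m := 2)))
  have hsrc : ∀ᶠ z in 𝓝 x, ι z ∈ (chartAt F (ι x)).source :=
    hι.continuous.continuousAt ((chartAt F (ι x)).open_source.mem_nhds (mem_chart_source F (ι x)))
  have hchain : ∀ z, ι z ∈ (chartAt F (ι x)).source → ∀ w : TangentSpace 𝓘(ℝ, E) z,
      (e ⟨ι z, mfderiv 𝓘(ℝ, E) 𝓘(ℝ, F) ι z w⟩).2 = mvfderiv 𝓘(ℝ, E) f z w := by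
    intro z hz w
    rw [trivializationAt_snd_eq_mvfderiv hz]
    exact (mfderiv_comp_apply z (mdifferentiableAt_extChartAt hz)
      ((hι z).mdifferentiableAt (by simp)) w).symm
  have key := mvfderiv_mlieBracket hf2 hU hV
  -- Vanishing torsion on the commuting extensions of `dι U` and `dι V`: the Christoffel terms agree.
  have ht := D.torsion_apply_eq_extend (mfderiv 𝓘(ℝ, E) 𝓘(ℝ, F) ι x (U x))
    (mfderiv 𝓘(ℝ, E) 𝓘(ℝ, F) ι x (V x))
  rw [hD, mlieBracket_extend, extend_apply_self, extend_apply_self] at ht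
  have ht' : D (extend F (mfderiv 𝓘(ℝ, E) 𝓘(ℝ, F) ι x (V x))) (ι x)
        (mfderiv 𝓘(ℝ, E) 𝓘(ℝ, F) ι x (U x)) =
      D (extend F (mfderiv 𝓘(ℝ, E) 𝓘(ℝ, F) ι x (U x))) (ι x)
        (mfderiv 𝓘(ℝ, E) 𝓘(ℝ, F) ι x (V x)) := by
    rw [sub_zero] at ht
    exact sub_eq_zero.mp ht.symm
  unfold derivAlong
  rw [← he, ht', add_sub_add_right_eq_sub, mvfderiv_congr (hsrc.mono fun z hz ↦ hchain z hz (V z)),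
    mvfderiv_congr (hsrc.mono fun z hz ↦ hchain z hz (U z)),
    ← e.coe_symmₗ (R := ℝ) (mem_baseSet_trivializationAt' (ι x)), ← map_sub, ← key,
    ← hchain x (mem_chart_source F (ι x)),
    e.coe_symmₗ (R := ℝ) (mem_baseSet_trivializationAt' (ι x))]
  exact e.symm_proj_apply ⟨ι x, _⟩ (mem_baseSet_trivializationAt' (ι x))

end AlongLemmas

/-! ### The radical distribution of an invariant lightlike submanifold -/

section Rad

variable {E : Type*} [NormedAddCommGroup E] [NormedSpace ℝ E]
  {F : Type*} [NormedAddCommGroup F] [NormedSpace ℝ F]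
  {M : Type*} [TopologicalSpace M] [ChartedSpace E M]
  {N : Type*} [TopologicalSpace N] [ChartedSpace F N] [IsManifold 𝓘(ℝ, F) ∞ N]
  {g : SemiRiemannianMetric F N} {ι : M → N}

/-- A vector field on `M` lying in `Rad(TM)` is a section of `Rad(TM)` along `ι`. -/
theorem IsRadField.isSection [IsManifold 𝓘(ℝ, E) ∞ M]
    (hι : ContMDiff 𝓘(ℝ, E) 𝓘(ℝ, F) ∞ ι) {U : ∀ x : M, TangentSpace 𝓘(ℝ, E) x}
    (hU : IsRadField g ι U) :
    IsSection E ι (rad E g ι) (fun x ↦ mfderiv 𝓘(ℝ, E) 𝓘(ℝ, F) ι x (U x)) where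
  contMDiff := (hι.contMDiff_tangentMap (by simp)).comp hU.contMDiff
  mem := hU.mem

namespace LightlikeSubmanifold

variable [FiniteDimensional ℝ F] (L : LightlikeSubmanifold E g ι)

theorem screenProj_eq_zero_iff_mem_rad {x : M} {v : TangentSpace 𝓘(ℝ, F) (ι x)}
    (hv : v ∈ tangent E F ι x) : L.screenProj x v = 0 ↔ v ∈ rad E g ι x := by
  refine (Submodule.projection_apply_eq_zero_iff (L.isCompl_screen x)).trans
    ⟨fun h ↦ ?_, fun h ↦ Submodule.mem_sup_left h⟩
  obtain ⟨a, ha, t, ht, rfl⟩ := Submodule.mem_sup.mp h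
  have htT : t ∈ tangent E F ι x := (Submodule.add_mem_iff_right _ ha.1).mp hv
  rwa [Submodule.disjoint_def.mp (L.isCompl_tangent x).disjoint t htT ht, add_zero]

/-- Projecting to `TM` first does not change the `S(TM)`-component, since `tr(TM)` lies in the
kernel of the screen projection. -/
theorem screenProj_tangentProj (x : M) (v : TangentSpace 𝓘(ℝ, F) (ι x)) :
    L.screenProj x (L.tangentProj x v) = L.screenProj x v := by
  have h : v - L.tangentProj x v ∈ rad E g ι x ⊔ L.tr x :=
    Submodule.mem_sup_right (Submodule.sub_projection_mem (L.isCompl_tangent x) v)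
  have h0 : L.screenProj x (v - L.tangentProj x v) = 0 :=
    (Submodule.projection_apply_eq_zero_iff (L.isCompl_screen x)).mpr h
  rw [map_sub, sub_eq_zero] at h0
  exact h0.symm

theorem screenShape_eq (D : CovariantDerivative 𝓘(ℝ, F) F (TangentSpace 𝓘(ℝ, F) : N → Type _))
    (V : ∀ x : M, TangentSpace 𝓘(ℝ, F) (ι x)) (x : M) (u : TangentSpace 𝓘(ℝ, E) x) :
    L.screenShape D V x u = -L.screenProj x (derivAlong D ι V x u) :=
  congrArg Neg.neg (L.screenProj_tangentProj x _)

theorem screenShape_eq_zero_iff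
    (D : CovariantDerivative 𝓘(ℝ, F) F (TangentSpace 𝓘(ℝ, F) : N → Type _))
    (V : ∀ x : M, TangentSpace 𝓘(ℝ, F) (ι x)) (x : M) (u : TangentSpace 𝓘(ℝ, E) x) :
    L.screenShape D V x u = 0 ↔ L.inducedDeriv D V x u ∈ rad E g ι x :=
  neg_eq_zero.trans <| L.screenProj_eq_zero_iff_mem_rad
    (Submodule.projection_apply_mem (L.isCompl_tangent x) _)

/-- The screen shape operator is additive and homogeneous in the section, so `J² = p J + q`
carries over to it. -/
theorem screenShape_endo_endo {p q : ℕ} (J : MetallicStructure g p q)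
    (hJ : ∀ x, (rad E g ι x).map (J.endo (ι x)).toLinearMap ≤ rad E g ι x)
    (D : CovariantDerivative 𝓘(ℝ, F) F (TangentSpace 𝓘(ℝ, F) : N → Type _))
    {V : ∀ x : M, TangentSpace 𝓘(ℝ, F) (ι x)} (hV : IsSection E ι (rad E g ι) V) (x : M)
    (u : TangentSpace 𝓘(ℝ, E) x) :
    L.screenShape D (fun z ↦ J.endo (ι z) (J.endo (ι z) (V z))) x u =
      (p : ℝ) • L.screenShape D (fun z ↦ J.endo (ι z) (V z)) x u +
        (q : ℝ) • L.screenShape D V x u := by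
  have hι : ContinuousAt ι x := L.isImmersion.contMDiff.continuous.continuousAt
  have hJV := J.isSection_endo L.isImmersion.contMDiff hJ hV
  simp_rw [J.sq, screenShape_eq]
  rw [derivAlong_add D hι ((hJV.const_smul p).contMDiff x) ((hV.const_smul q).contMDiff x),
    derivAlong_smul D _ hι (hJV.contMDiff x), derivAlong_smul D _ hι (hV.contMDiff x),
    map_add, map_smul, map_smul, neg_add, smul_neg, smul_neg]

variable [CompleteSpace E] [IsManifold 𝓘(ℝ, E) ∞ M]

/-- `Rad(TM)` defines a totally geodesic foliation as soon as the screen shape operators vanish on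
it: involutivity then comes for free. Indeed the two connections differ by `π(V) J U ∈ Rad(TM)`, so
the `S(TM)`-components of `∇_U V` and `∇_V U` vanish, and `∇` is torsion-free. -/
theorem radTotallyGeodesic_iff {p q : ℕ} (J : MetallicStructure g p q)
    (hJ : ∀ x, (rad E g ι x).map (J.endo (ι x)).toLinearMap ≤ rad E g ι x)
    {nabla : CovariantDerivative 𝓘(ℝ, F) F (TangentSpace 𝓘(ℝ, F) : N → Type _)}
    (hnabla : nabla.torsion = 0) (η : ∀ y : N, TangentSpace 𝓘(ℝ, F) y) :
    L.RadTotallyGeodesic (quarterSymmetricConnection J nabla η) ↔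
      ∀ (U : ∀ x : M, TangentSpace 𝓘(ℝ, E) x) (V : ∀ x : M, TangentSpace 𝓘(ℝ, F) (ι x)),
        IsRadField g ι U → IsSection E ι (rad E g ι) V → ∀ x,
          L.screenShape (quarterSymmetricConnection J nabla η) V x (U x) = 0 := by
  have hι := L.isImmersion.contMDiff
  refine ⟨fun h U V hU hV x ↦ (L.screenShape_eq_zero_iff _ V x _).mpr
    (h.inducedDeriv_mem U V hU hV x), fun h ↦ ⟨fun U V hU hV x ↦ ?_, fun U V hU hV x ↦
    (L.screenShape_eq_zero_iff _ V x _).mp (h U V hU hV x)⟩⟩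
  have h0 : ∀ {U V : ∀ x : M, TangentSpace 𝓘(ℝ, E) x}, IsRadField g ι U → IsRadField g ι V →
      L.screenProj x (derivAlong nabla ι (fun z ↦ mfderiv 𝓘(ℝ, E) 𝓘(ℝ, F) ι z (V z)) x (U x)) =
        0 := by
    intro U V hU hV
    have h1 := h U _ hU (hV.isSection hι) x
    have h2 : L.screenProj x (J.endo (ι x) (mfderiv 𝓘(ℝ, E) 𝓘(ℝ, F) ι x (U x))) = 0 :=
      (Submodule.projection_apply_eq_zero_iff (L.isCompl_screen x)).mpr <|
        Submodule.mem_sup_left (hJ x (Submodule.mem_map_of_mem (hU.mem x)))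
    rwa [screenShape_eq, derivAlong_quarterSymmetricConnection, map_add, map_smul, h2, smul_zero,
      add_zero, neg_eq_zero] at h1
  refine (L.screenProj_eq_zero_iff_mem_rad (LinearMap.mem_range_self _ _)).mp ?_
  have hb := derivAlong_sub_derivAlong hnabla hι
    ((hU.contMDiff x).mdifferentiableAt (by simp)) ((hV.contMDiff x).mdifferentiableAt (by simp))
  change L.screenProj x (mfderiv 𝓘(ℝ, E) 𝓘(ℝ, F) ι x _) = 0
  rw [← hb, map_sub, h0 hU hV, h0 hV hU, sub_zero]

/-- `Rad(TM)` defines a totally geodesic foliation if and only if `A^*_{JV} = c A^*_V` on it, for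
any `c` that is not a root of the polynomial `X² - p X - q` of `J`: applying the relation to `V` and
to `J V` and comparing with `J² = p J + q` gives `(c² - p c - q) A^*_V = 0`. -/
theorem radTotallyGeodesic_iff_screenShape_endo {p q : ℕ} (J : MetallicStructure g p q)
    (hJ : ∀ x, (rad E g ι x).map (J.endo (ι x)).toLinearMap ≤ rad E g ι x)
    {nabla : CovariantDerivative 𝓘(ℝ, F) F (TangentSpace 𝓘(ℝ, F) : N → Type _)}
    (hnabla : nabla.torsion = 0) (η : ∀ y : N, TangentSpace 𝓘(ℝ, F) y) {c : ℝ}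
    (hc : c ^ 2 ≠ p * c + q) :
    L.RadTotallyGeodesic (quarterSymmetricConnection J nabla η) ↔
      ∀ (U : ∀ x : M, TangentSpace 𝓘(ℝ, E) x) (V : ∀ x : M, TangentSpace 𝓘(ℝ, F) (ι x)),
        IsRadField g ι U → IsSection E ι (rad E g ι) V → ∀ x,
          L.screenShape (quarterSymmetricConnection J nabla η)
              (fun z ↦ J.endo (ι z) (V z)) x (U x) =
            c • L.screenShape (quarterSymmetricConnection J nabla η) V x (U x) := by
  rw [L.radTotallyGeodesic_iff J hJ hnabla η]
  refine ⟨fun h U V hU hV x ↦ ?_, fun h U V hU hV x ↦ ?_⟩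
  · rw [h U V hU hV x, h U _ hU (J.isSection_endo L.isImmersion.contMDiff hJ hV) x, smul_zero]
  · have h1 := h U V hU hV x
    have h2 := h U _ hU (J.isSection_endo L.isImmersion.contMDiff hJ hV) x
    rw [L.screenShape_endo_endo J hJ _ hV, h1] at h2
    have h3 : (c ^ 2 - (p * c + q)) •
        L.screenShape (quarterSymmetricConnection J nabla η) V x (U x) = 0 := by
      rw [sub_smul, sub_eq_zero, sq, mul_smul, ← h2, add_smul, mul_smul]
    exact (smul_eq_zero.mp h3).resolve_left (sub_ne_zero.mpr hc)

end LightlikeSubmanifold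

end Rad

end LightlikeGeometry

open LightlikeGeometry
theorem mainTheorem3
    {E : Type*} [NormedAddCommGroup E] [NormedSpace ℝ E] [FiniteDimensional ℝ E]
    {F : Type*} [NormedAddCommGroup F] [NormedSpace ℝ F] [FiniteDimensional ℝ F]
    {M : Type*} [TopologicalSpace M] [T2Space M] [SecondCountableTopology M]
    [ChartedSpace E M] [IsManifold 𝓘(ℝ, E) ∞ M]
    {N : Type*} [TopologicalSpace N] [T2Space N] [SecondCountableTopology N]
    [ChartedSpace F N] [IsManifold 𝓘(ℝ, F) ∞ N]
    (g : SemiRiemannianMetric F N) {p q : ℕ} (hp : 0 < p) (hq : 0 < q)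
    (J : MetallicStructure g p q)
    (nabla : CovariantDerivative 𝓘(ℝ, F) F (TangentSpace 𝓘(ℝ, F) : N → Type _))
    (hnabla : IsLeviCivita g nabla)
    (η : ∀ y : N, TangentSpace 𝓘(ℝ, F) y)
    (hη : ContMDiff 𝓘(ℝ, F) 𝓘(ℝ, F).tangent ∞
      (fun y ↦ (⟨y, η y⟩ : TangentBundle 𝓘(ℝ, F) N)))
    (D : CovariantDerivative 𝓘(ℝ, F) F (TangentSpace 𝓘(ℝ, F) : N → Type _))
    (hD : D = quarterSymmetricConnection J nabla η)
    (ι : M → N) (L : LightlikeSubmanifold E g ι) (hL : L.IsInvariant J) :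
    (L.RadTotallyGeodesic D ↔
      ∀ (U : ∀ x : M, TangentSpace 𝓘(ℝ, E) x) (V : ∀ x : M, TangentSpace 𝓘(ℝ, F) (ι x)),
        IsRadField g ι U → IsSection E ι (rad E g ι) V → ∀ x,
          L.screenShape D (fun z ↦ J.endo (ι z) (V z)) x (U x) =
            (p : ℝ) • L.screenShape D V x (U x)) ∧
    (q ≠ 2 * p ^ 2 →
      (L.RadTotallyGeodesic D ↔
        ∀ (U : ∀ x : M, TangentSpace 𝓘(ℝ, E) x) (V : ∀ x : M, TangentSpace 𝓘(ℝ, F) (ι x)),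
          IsRadField g ι U → IsSection E ι (rad E g ι) V → ∀ x,
            L.screenShape D (fun z ↦ J.endo (ι z) (V z)) x (U x) =
              -(p : ℝ) • L.screenShape D V x (U x))) := by
  subst hD
  have : CompleteSpace E := FiniteDimensional.complete ℝ E
  have hJ := fun x ↦ (hL.map_rad x).le
  refine ⟨L.radTotallyGeodesic_iff_screenShape_endo J hJ hnabla.torsion_eq_zero η ?_, fun hpq ↦
    L.radTotallyGeodesic_iff_screenShape_endo J hJ hnabla.torsion_eq_zero η ?_⟩
  -- `c = p` is a root of `X² - p X - q` only if `q = 0`.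
  · intro h
    have : (q : ℝ) = 0 := by linear_combination -h
    exact hq.ne' (mod_cast this)
  -- `c = -p` is a root of `X² - p X - q` only if `q = 2 p²`.
  · intro h
    have : (q : ℝ) = 2 * (p : ℝ) ^ 2 := by linear_combination -h
    exact hpq (mod_cast this)
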